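/- **Setting.** Let $G$ be a graph on knots $K_1,\dots,K_s$, let $L_{ij}>0$ be an undeformed length for each edge $e_{ij}$ ($i<j$), and let some triangles $K_iK_jK_k$ of $G$ ($i<j<k$), whose undeformed lengths satisfy the strict triangle inequalities, be materialized by triangular plates. All edges that are not sides of a plate are bars with the same cross-sectional area $A>0$. A realization $G(\mathbf k)$ in Euclidean $n$-space is given by $\mathbf k=(\mathbf k_1,\dots,\mathbf k_s)\in(\mathbb R^n)^s$; it is undeformed if $\|\mathbf k_i-\mathbf k_j\|=L_{ij}$ for all edges, otherwise deformed. It is shaky if it has an infinitesimal motion $\mathbf v$ (i.e. $\langle \mathbf k_i-\mathbf k_j,\mathbf v_i-\mathbf v_j\rangle=0$ for all edges) that is not induced by a rigid motion of space, i.e. not of the form $\mathbf v_i=S\mathbf k_i+\mathbf a$ with $S$ skew-symmetric. The framework is isostatic: $G$ is generically rigid in $\mathbb R^n$ (some, equivalently a generic, realization is not shaky), and no longer so after the removal of any edge. The Green-Lagrange (GL) strain energy $U(\mathbf k')$ of a realization, with edge lengths $L'_{ij}=\|\mathbf k'_i-\mathbf k'_j\|$, is the sum of the energies $\frac{A}{8L_{ij}^3}(L'_{ij}-L_{ij})^2(L'_{ij}+L_{ij})^2$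 of the bars and the energies $\frac12A(L_{ij}+L_{ik}+L_{jk})\,\mathbf e^T\mathbf D\mathbf e$ of the plates. Here $\mathbf e=(\varepsilon_x,\varepsilon_y,2\gamma_{xy})^T$ with $\begin{pmatrix}\varepsilon_x&\gamma_{xy}\\ \gamma_{xy}&\varepsilon_y\end{pmatrix}=\frac12(\mathbf A^T\mathbf A-\mathbf I)$, where $\mathbf A$ is the matrix of the linear map taking the undeformed edge vectors of the plate to the deformed ones (in planar Cartesian frames of the two triangles), and $\mathbf D=\frac{1}{1-\nu^2}\begin{pmatrix}1&\nu&0\\ \nu&1&0\\ 0&0&\frac{1-\nu}2\end{pmatrix}$ with $\nu=\frac12$. A realization is stable if it is a local minimum of $U$. A snap out of a stable realization $G(\mathbf k)$ into a stable realization $G(\mathbf k'')$ is a continuous deformation from $\mathbf k$ to $\mathbf k''$, where the two are separated by an energy barrier: every continuous path from $\mathbf k$ to $\mathbf k''$ passes a point at which $U>U(\mathbf k)$. It applies the minimum strain energy if the maximum of $U$ along it is minimal among all continuous deformations from $\mathbf k$ to $\mathbf k''$. **Theorem 2.** If an isostatic framework of bars and triangular plates snaps out of a stable realization $G(\mathbf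 k)$ into $G(\mathbf k'')$ by applying the minimum GL strain energy, then the deformation passes, strictly between its start and its end, a shaky realization $G(\mathbf k')$ at the maximum state of deformation, i.e. one at which $U$ attains its maximum along the deformation. The final realization $G(\mathbf k'')$ is either undeformed, or deformed and shaky. -/

import Mathlib

/-- A configuration of `s` knots in Euclidean `n`-space: the coordinate vectors of the knots. -/
abbrev Configuration (n s : ℕ) : Type := Fin s → EuclideanSpace ℝ (Fin n)

/-! ### First-order rigidity -/

/-- `v` assigns to each knot a velocity that, to first order, preserves all edge lengths of the
realization `k` of `G`. -/
def IsInfinitesimalMotion {n s : ℕ} (G : SimpleGraph (Fin s)) (k v : Configuration n s) : Prop :=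
  ∀ i j, G.Adj i j → inner ℝ (k i - k j) (v i - v j) = 0

/-- `v` is the restriction to the knots of the velocity field `x ↦ S x + a` (with `S` skew) of a
rigid motion of Euclidean `n`-space. -/
def IsTrivialMotion {n s : ℕ} (k v : Configuration n s) : Prop :=
  ∃ (S : EuclideanSpace ℝ (Fin n) →ₗ[ℝ] EuclideanSpace ℝ (Fin n)) (a : EuclideanSpace ℝ (Fin n)),
    (∀ x y, inner ℝ (S x) y = -inner ℝ x (S y)) ∧ ∀ i, v i = S (k i) + a

/-- A realization is shaky (infinitesimally flexible) if it admits an infinitesimal motion that is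
not induced by a rigid motion of the space. -/
def IsShaky {n s : ℕ} (G : SimpleGraph (Fin s)) (k : Configuration n s) : Prop :=
  ∃ v : Configuration n s, IsInfinitesimalMotion G k v ∧ ¬ IsTrivialMotion k v

/-- `G` is generically rigid in Euclidean `n`-space: some realization (equivalently, a generic
one) is not shaky. -/
def IsGenericallyRigid (n : ℕ) {s : ℕ} (G : SimpleGraph (Fin s)) : Prop :=
  ∃ p : Configuration n s, ¬ IsShaky G p

/-- `G` is isostatic in Euclidean `n`-space: it is generically rigid, and the removal of any edge
makes it flexible. -/
def IsIsostatic (n : ℕ) {s : ℕ} (G : SimpleGraph (Fin s)) : Prop :=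
  IsGenericallyRigid n G ∧ ∀ e ∈ G.edgeSet, ¬ IsGenericallyRigid n (G.deleteEdges {e})

/-! ### Frameworks of bars and triangular plates -/

/-- A framework composed of bars and triangular plates: a graph on `s` knots, an undeformed length
`length i j > 0` for each edge `i < j`, a set of triangles `i < j < k` of the graph that are
materialized by (nondegenerate) triangular plates, and the common cross-sectional area of the bars.
Only the values `length i j` for edges with `i < j` matter. -/
structure BarPlateFramework (s : ℕ) where
  graph : SimpleGraph (Fin s)
  length : Fin s → Fin s → ℝ
  length_pos : ∀ i j, i < j → graph.Adj i j → 0 < length i j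
  plates : Finset (Fin s × Fin s × Fin s)
  plate_lt : ∀ i j k, (i, j, k) ∈ plates → i < j ∧ j < k
  plate_adj : ∀ i j k, (i, j, k) ∈ plates → graph.Adj i j ∧ graph.Adj i k ∧ graph.Adj j k
  plate_triangle : ∀ i j k, (i, j, k) ∈ plates →
    length i j < length i k + length j k ∧
    length i k < length i j + length j k ∧
    length j k < length i j + length i k
  area : ℝ
  area_pos : 0 < area

/-- Green-Lagrange strain energy of a bar with undeformed length `L`, deformed length `L'` and
cross-sectional area `A` (modulus of elasticity one). -/
noncomputable def barEnergy (A L L' : ℝ) : ℝ :=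
  A / (8 * L ^ 3) * (L' - L) ^ 2 * (L' + L) ^ 2

/-- The planar stress/strain matrix with modulus of elasticity `E` and Poisson's ratio `ν`. -/
noncomputable def constitutiveMatrix (E ν : ℝ) : Matrix (Fin 3) (Fin 3) ℝ :=
  (E / (1 - ν ^ 2)) • !![1, ν, 0; ν, 1, 0; 0, 0, (1 - ν) / 2]

/-- The edge vectors `K_i K_j` and `K_i K_k` (as columns) of a planar triangle with side lengths
`a = |K_i K_j|`, `b = |K_i K_k|`, `c = |K_j K_k|`, placed with `K_i` at the origin and `K_j` on the
positive first axis. -/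
noncomputable def undeformedEdges (a b c : ℝ) : Matrix (Fin 2) (Fin 2) ℝ :=
  !![a, (a ^ 2 + b ^ 2 - c ^ 2) / (2 * a);
     0, Real.sqrt ((a + b + c) * (a - b + c) * (a + b - c) * (b + c - a)) / (2 * a)]

/-- The edge vectors `K'_i K'_j` and `K'_i K'_k` (as columns) of the deformed triangle. -/
def deformedEdges {n : ℕ} (x y z : EuclideanSpace ℝ (Fin n)) : Matrix (Fin n) (Fin 2) ℝ :=
  Matrix.of fun l => ![y l - x l, z l - x l]

/-- The matrix mapping the undeformed edge vectors of the triangle to the deformed ones. The image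
is expressed in the coordinates of the ambient space instead of those of a planar Cartesian frame
of the deformed triangle; this does not affect `Fᵀ * F`, see
`deformationGradient_transpose_mul_self`. -/
noncomputable def deformationGradient {n : ℕ} (a b c : ℝ) (x y z : EuclideanSpace ℝ (Fin n)) :
    Matrix (Fin n) (Fin 2) ℝ :=
  deformedEdges x y z * (undeformedEdges a b c)⁻¹

theorem undeformedEdges_det_ne_zero {a b c : ℝ} (ha : 0 < a)
    (h1 : a < b + c) (h2 : b < a + c) (h3 : c < a + b) :
    (undeformedEdges a b c).det ≠ 0 := by
  have h : 0 < (a + b + c) * (a - b + c) * (a + b - c) * (b + c - a) := by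
    have e1 : 0 < a + b + c := by linarith
    have e2 : 0 < a - b + c := by linarith
    have e3 : 0 < a + b - c := by linarith
    have e4 : 0 < b + c - a := by linarith
    positivity
  have h' := Real.sqrt_pos.2 h
  have : (undeformedEdges a b c).det =
      a * (Real.sqrt ((a + b + c) * (a - b + c) * (a + b - c) * (b + c - a)) / (2 * a)) := by
    simp [undeformedEdges, Matrix.det_fin_two]
  rw [this]
  positivity

/-- If the columns of `Q` are an orthonormal frame of a plane parallel to the deformed triangle, and
`A` is the `2 × 2` matrix that maps the undeformed edge vectors to the coordinates of the deformed
ones in that frame, then `A` has the same Gram matrix as the deformation gradient. -/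
theorem deformationGradient_transpose_mul_self {n : ℕ} {a b c : ℝ} (ha : 0 < a)
    (h1 : a < b + c) (h2 : b < a + c) (h3 : c < a + b) (x y z : EuclideanSpace ℝ (Fin n))
    (Q : Matrix (Fin n) (Fin 2) ℝ) (hQ : Q.transpose * Q = 1) (A : Matrix (Fin 2) (Fin 2) ℝ)
    (hA : Q * (A * undeformedEdges a b c) = deformedEdges x y z) :
    (deformationGradient a b c x y z).transpose * deformationGradient a b c x y z =
      A.transpose * A := by
  have hu : IsUnit (undeformedEdges a b c).det :=
    isUnit_iff_ne_zero.2 (undeformedEdges_det_ne_zero ha h1 h2 h3)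
  have h : deformationGradient a b c x y z = Q * A := by
    rw [deformationGradient, ← hA, Matrix.mul_assoc, Matrix.mul_assoc,
      Matrix.mul_nonsing_inv _ hu, Matrix.mul_one]
  rw [h, Matrix.transpose_mul, Matrix.mul_assoc, ← Matrix.mul_assoc Q.transpose, hQ,
    Matrix.one_mul]

/-- The Green-Lagrange strain matrix of the triangle. -/
noncomputable def greenLagrangeStrain {n : ℕ} (a b c : ℝ) (x y z : EuclideanSpace ℝ (Fin n)) :
    Matrix (Fin 2) (Fin 2) ℝ :=
  (1 / 2 : ℝ) •
    ((deformationGradient a b c x y z).transpose * deformationGradient a b c x y z - 1)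

/-- The strain vector `(ε_x, ε_y, 2 γ_xy)`. -/
noncomputable def strainVector {n : ℕ} (a b c : ℝ) (x y z : EuclideanSpace ℝ (Fin n)) :
    Fin 3 → ℝ :=
  ![greenLagrangeStrain a b c x y z 0 0, greenLagrangeStrain a b c x y z 1 1,
    2 * greenLagrangeStrain a b c x y z 0 1]

/-- Green-Lagrange strain energy of a triangular plate with undeformed side lengths `a`, `b`, `c`
and deformed vertices `x`, `y`, `z`. The volume of the plate is that of the three bars which it
replaces; modulus of elasticity one, Poisson's ratio one-half. -/
noncomputable def plateEnergy {n : ℕ} (A a b c : ℝ) (x y z : EuclideanSpace ℝ (Fin n)) : ℝ :=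
  (A * (a + b + c)) * (1 / 2) *
    (strainVector a b c x y z ⬝ᵥ
      Matrix.mulVec (constitutiveMatrix 1 (1 / 2)) (strainVector a b c x y z))

namespace BarPlateFramework

variable {n s : ℕ} (F : BarPlateFramework s)

/-- The edge `i < j` is a side of one of the plates. -/
def IsPlateSide (i j : Fin s) : Prop :=
  ∃ k, (i, j, k) ∈ F.plates ∨ (i, k, j) ∈ F.plates ∨ (k, i, j) ∈ F.plates

open Classical in
/-- The bars: the edges `i < j` that have not been replaced by a plate. -/
noncomputable def bars : Finset (Fin s × Fin s) :=
  Finset.univ.filter fun e => e.1 < e.2 ∧ F.graph.Adj e.1 e.2 ∧ ¬ F.IsPlateSide e.1 e.2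

/-- The total elastic Green-Lagrange strain energy of the realization `k` of the framework. -/
noncomputable def energy (k : Configuration n s) : ℝ :=
  ∑ e ∈ F.bars, barEnergy F.area (F.length e.1 e.2) (dist (k e.1) (k e.2)) +
  ∑ p ∈ F.plates, plateEnergy F.area
    (F.length p.1 p.2.1) (F.length p.1 p.2.2) (F.length p.2.1 p.2.2)
    (k p.1) (k p.2.1) (k p.2.2)

/-- All edges have their undeformed lengths. -/
def IsUndeformed (k : Configuration n s) : Prop :=
  ∀ i j, i < j → F.graph.Adj i j → dist (k i) (k j) = F.length i j

/-- A realization is stable if it is a local minimum of the strain energy. -/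
def IsStable (k : Configuration n s) : Prop :=
  IsLocalMin (F.energy (n := n)) k

/-- The highest strain energy reached during a continuous deformation. (The strain energy is
continuous, so this is a maximum.) -/
noncomputable def peakEnergy {k k'' : Configuration n s} (γ : Path k k'') : ℝ :=
  ⨆ t : unitInterval, F.energy (γ t)

/-- The framework can snap from `k` into `k''`: both realizations are stable, and they are separated
by an energy barrier, i.e. no continuous deformation leads from `k` to `k''` unless strain energy
is supplied to the framework. (In particular `k''` is not directly congruent to `k`.) -/
def CanSnap (k k'' : Configuration n s) : Prop :=
  F.IsStable k ∧ F.IsStable k'' ∧ ∀ γ : Path k k'', ∃ t, F.energy k < F.energy (γ t)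

/-- The deformation `γ` from `k` to `k''` needs the minimum strain energy: no deformation
from `k` to `k''` gets by with a lower peak energy. (This holds in particular if `γ` has the lowest
peak energy among all snaps out of `k`, into whatever realization.) -/
def UsesMinimumEnergy {k k'' : Configuration n s} (γ : Path k k'') : Prop :=
  ∀ δ : Path k k'', F.peakEnergy γ ≤ F.peakEnergy δ

end BarPlateFramework

/-! The energy is a nonnegative quadratic form in the deviations `d_ij = ‖k_i - k_j‖² - L_ij²`: for
bars this is immediate, and for plates the strain is linear in the change of the Gram matrix of the
edge vectors, hence in the `d_ij`. At a non-shaky realization of an isostatic graph the edges are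
independent, so some velocity changes every `d_ij` at rate `d_ij`. By Euler's identity the energy
then has derivative `2U` in that direction. So a critical point with `U ≠ 0` is shaky
(`isShaky_of_fderiv_eq_zero`). Since `U = 0` forces all edges to be undeformed, this settles the
stable final realization.

For the peak there is a minimax argument. If the end lies below the peak level and no interior peak
point is shaky, then no point of the path at that level is critical. Pushing the path against an
ascent field gives a competitor with a lower peak (`exists_path_lt_of_regular`), against minimality.
If the end lies at the peak level, local minimality there forces the path to be constant in energy
just before the end, and those points are local minima too, hence shaky. -/

open Filter Topology

/-! ### Lowering the peak of a path without critical points at its top level -/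

section PathLowering

variable {E : Type*} [NormedAddCommGroup E] [NormedSpace ℝ E]

/-- A `C¹` function on a finite-dimensional space has a continuous vector field along which its
derivative is positive away from the critical points. -/
theorem exists_continuous_ascent_field [FiniteDimensional ℝ E] {f : E → ℝ}
    (hf : ContDiff ℝ 1 f) :
    ∃ V : E → E, Continuous V ∧ ∀ x, fderiv ℝ f x ≠ 0 → 0 < fderiv ℝ f x (V x) := by
  let b := Module.finBasis ℝ E
  -- The gradient in coordinates of a basis: the derivative along it is a sum of squares.
  refine ⟨fun x => ∑ i, (fderiv ℝ f x (b i)) • b i, ?_, fun x hx => ?_⟩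
  · have hc : Continuous (fderiv ℝ f) := hf.continuous_fderiv one_ne_zero
    fun_prop
  · rw [map_sum]
    simp only [map_smul, smul_eq_mul]
    obtain ⟨i, hi⟩ : ∃ i, fderiv ℝ f x (b i) ≠ 0 := by
      by_contra! h
      exact hx (ContinuousLinearMap.coe_injective (b.ext fun i => by simpa using h i))
    exact Finset.sum_pos' (fun j _ => mul_self_nonneg _)
      ⟨i, Finset.mem_univ i, mul_self_pos.2 hi⟩

/-- Moving a family of points a little against an ascent direction lowers the function, locally
uniformly in the parameter. -/
theorem eventually_lt_of_ascent {T : Type*} [TopologicalSpace T] {f : E → ℝ}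
    (hf : ContDiff ℝ 1 f) {c w : T → E} (hc : Continuous c) (hw : Continuous w) {t₀ : T}
    (h : 0 < fderiv ℝ f (c t₀) (w t₀)) :
    ∀ᶠ z : ℝ × T in 𝓝 ((0 : ℝ), t₀), 0 < z.1 → f (c z.2 - z.1 • w z.2) < f (c z.2) := by
  have hcont : Continuous fun z : ℝ × T => fderiv ℝ f (c z.2 - z.1 • w z.2) (w z.2) := by
    have hc' : Continuous (fderiv ℝ f) := hf.continuous_fderiv one_ne_zero
    fun_prop
  have hpos : ∀ᶠ z : ℝ × T in 𝓝 ((0 : ℝ), t₀),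
      0 < fderiv ℝ f (c z.2 - z.1 • w z.2) (w z.2) :=
    hcont.continuousAt.eventually (lt_mem_nhds (by simpa using h))
  rw [nhds_prod_eq, eventually_prod_iff] at hpos
  obtain ⟨p, hp, q, hq, hpq⟩ := hpos
  obtain ⟨r, hr, hball⟩ := Metric.eventually_nhds_iff.1 hp
  have hlt : ∀ᶠ ε : ℝ in 𝓝 0, ε < r := Iio_mem_nhds hr
  rw [nhds_prod_eq]
  refine (hlt.prod_mk hq).mono ?_
  rintro ⟨ε, t⟩ ⟨hε, ht⟩ h0
  simp only at hε ht h0 ⊢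
  have hd : ∀ τ : ℝ, HasDerivAt (fun τ : ℝ => f (c t - τ • w t))
      (-(fderiv ℝ f (c t - τ • w t) (w t))) τ := by
    intro τ
    have h1 : HasDerivAt (fun τ : ℝ => c t - τ • w t) (-(w t)) τ := by
      simpa using ((hasDerivAt_id τ).smul_const (w t)).const_sub (c t)
    exact (((hf.differentiable one_ne_zero) (c t - τ • w t)).hasFDerivAt.comp_hasDerivAt τ
      h1).congr_deriv (map_neg _ _)
  -- Mean value theorem along the segment, on which the derivative along `w t` stays positive.
  obtain ⟨τ, hτ, hslope⟩ := exists_hasDerivAt_eq_slope (fun τ : ℝ => f (c t - τ • w t)) _ h0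
    (fun τ _ => (hd τ).continuousAt.continuousWithinAt) (fun τ _ => hd τ)
  have hτpos : 0 < fderiv ℝ f (c t - τ • w t) (w t) := by
    refine hpq (hball ?_) ht
    rw [Real.dist_eq, sub_zero, abs_of_pos hτ.1]
    exact hτ.2.trans hε
  have hneg : (f (c t - ε • w t) - f (c t - (0 : ℝ) • w t)) / (ε - 0) < 0 := by
    rw [← hslope]; linarith
  rw [sub_zero, zero_smul, sub_zero, div_neg_iff] at hneg
  rcases hneg with h | h <;> linarith [h.1, h.2]

/-- A path on which a `C¹` function has no critical point at its highest level, a level which lies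
above the endpoints, can be replaced by a path that stays strictly below that level. -/
theorem exists_path_lt_of_regular [FiniteDimensional ℝ E] {f : E → ℝ}
    (hf : ContDiff ℝ 1 f) {x y : E} (γ : Path x y) {M : ℝ} (hM : ∀ t, f (γ t) ≤ M)
    (hx : f x < M) (hy : f y < M) (hreg : ∀ t, f (γ t) = M → fderiv ℝ f (γ t) ≠ 0) :
    ∃ δ : Path x y, ∀ t, f (δ t) < M := by
  obtain ⟨V, hV, hVpos⟩ := exists_continuous_ascent_field hf
  have hfc : Continuous f := hf.continuous
  -- The cutoff vanishes at both ends, so the endpoints stay fixed, and is positive wherever `f`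
  -- exceeds both end values, in particular at level `M`.
  let ρ : unitInterval → ℝ := fun t => max 0 (f (γ t) - max (f x) (f y))
  have hρ : Continuous ρ := by fun_prop
  let w : unitInterval → E := fun t => ρ t • V (γ t)
  have hw : Continuous w := by fun_prop
  have hloc : ∀ t ∈ (Set.univ : Set unitInterval), ∀ᶠ z : ℝ × unitInterval in 𝓝 ((0 : ℝ), t),
      0 < z.1 → f (γ z.2 - z.1 • w z.2) < M := by
    intro t _
    rcases (hM t).lt_or_eq with ht | ht
    · have hcont : Continuous fun z : ℝ × unitInterval => f (γ z.2 - z.1 • w z.2) := by fun_prop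
      filter_upwards [hcont.continuousAt.eventually
        (gt_mem_nhds (a := M) (by simpa using ht))] with z hz _ using hz
    · have hρt : 0 < ρ t := lt_max_of_lt_right (by rw [ht]; exact sub_pos.2 (max_lt hx hy))
      have hpos : 0 < fderiv ℝ f (γ t) (w t) := by
        simp only [w, map_smul, smul_eq_mul]
        exact mul_pos hρt (hVpos _ (hreg t ht))
      filter_upwards [eventually_lt_of_ascent hf γ.continuous hw hpos] with z hz h0
        using (hz h0).trans_le (hM _)
  -- Compactness of the interval turns the local step sizes into a single one.
  have hunif := isCompact_univ.eventually_forall_of_forall_eventually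
    (P := fun (ε : ℝ) (t : unitInterval) => 0 < ε → f (γ t - ε • w t) < M) (x₀ := 0) hloc
  obtain ⟨ε, hε, hεpos⟩ :=
    ((hunif.filter_mono nhdsWithin_le_nhds).and (self_mem_nhdsWithin (s := Set.Ioi (0 : ℝ)))).exists
  refine ⟨⟨⟨fun t => γ t - ε • w t, by fun_prop⟩, ?_, ?_⟩, fun t => hε t trivial hεpos⟩
  · simp [w, ρ]
  · simp [w, ρ]

end PathLowering

/-! ### Independence of the edges of an isostatic graph -/

section Rigidity

variable {n s : ℕ}

/-- In a non-shaky realization of an isostatic graph the rates of change of the squared edge lengths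
can be prescribed arbitrarily. -/
theorem IsIsostatic.exists_velocity {G : SimpleGraph (Fin s)} (hG : IsIsostatic n G)
    {k : Configuration n s} (hk : ¬ IsShaky G k) (μ : Fin s → Fin s → ℝ) :
    ∃ v : Configuration n s, ∀ i j, i < j → G.Adj i j →
      inner ℝ (k i - k j) (v i - v j) = μ i j := by
  let I := {e : Fin s × Fin s // e.1 < e.2 ∧ G.Adj e.1 e.2}
  let R : Configuration n s →ₗ[ℝ] (I → ℝ) := LinearMap.pi fun e =>
    (innerₗ (EuclideanSpace ℝ (Fin n)) (k e.1.1 - k e.1.2)).comp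
      ((LinearMap.proj e.1.1 : Configuration n s →ₗ[ℝ] EuclideanSpace ℝ (Fin n)) -
        LinearMap.proj e.1.2)
  have hR : ∀ v (e : I), R v e = inner ℝ (k e.1.1 - k e.1.2) (v e.1.1 - v e.1.2) := fun v e => rfl
  suffices hsurj : LinearMap.range R = ⊤ by
    obtain ⟨v, hv⟩ := LinearMap.range_eq_top.1 hsurj fun e => μ e.1.1 e.1.2
    exact ⟨v, fun i j hij ha => by rw [← hR v ⟨(i, j), hij, ha⟩, hv]⟩
  by_contra hne
  -- `g` is a nonzero self-stress. An edge `e₀` that carries stress is redundant: a motion of the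
  -- graph without `e₀` has `R v` supported on `e₀`, and `g (R v) = 0` makes that entry vanish too.
  -- So `k` stays non-shaky after deleting `e₀`, against isostaticity.
  obtain ⟨g, hg, hker⟩ := Submodule.exists_le_ker_of_lt_top _ (lt_top_iff_ne_top.2 hne)
  classical
  obtain ⟨e₀, he₀⟩ : ∃ e, g (Pi.single e 1) ≠ 0 := by
    by_contra! h
    exact hg ((Pi.basisFun ℝ I).ext fun e => by simpa using h e)
  refine hG.2 s(e₀.1.1, e₀.1.2) e₀.2.2 ⟨k, ?_⟩
  rintro ⟨v, hv, hnt⟩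
  refine hk ⟨v, ?_, hnt⟩
  have hoff : ∀ e : I, e ≠ e₀ → R v e = 0 := by
    intro e he
    rw [hR]
    refine hv _ _ (SimpleGraph.deleteEdges_adj.2 ⟨e.2.2, fun hmem => he ?_⟩)
    rw [Set.mem_singleton_iff, Sym2.eq_iff] at hmem
    rcases hmem with ⟨h1, h2⟩ | ⟨h1, h2⟩
    · exact Subtype.ext (Prod.ext h1 h2)
    · have h3 := e.2.1
      rw [h1, h2] at h3
      exact absurd h3 e₀.2.1.asymm
  have hRv : R v = R v e₀ • Pi.single e₀ 1 := by
    ext e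
    by_cases he : e = e₀
    · subst he; simp
    · simp [hoff e he, he]
  have hon : R v e₀ = 0 := by
    have h : g (R v) = 0 := hker (LinearMap.mem_range_self R v)
    rw [hRv, map_smul, smul_eq_mul] at h
    exact (mul_eq_zero.1 h).resolve_right he₀
  have hall : ∀ i j, i < j → G.Adj i j → inner ℝ (k i - k j) (v i - v j) = 0 := by
    intro i j hij ha
    rw [← hR v ⟨(i, j), hij, ha⟩, hRv, hon]
    simp
  intro i j ha
  rcases lt_or_gt_of_ne ha.ne with hij | hij
  · exact hall i j hij ha
  · rw [← neg_sub (k j), ← neg_sub (v j), inner_neg_neg]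
    exact hall j i hij ha.symm

end Rigidity

/-! ### Energies of single bars and plates, and their Euler identities -/

section Energy

variable {n s : ℕ}

/-- In this form only the squared length enters, so the energy is smooth even where knots coincide.
-/
theorem barEnergy_eq (A L L' : ℝ) : barEnergy A L L' = A / (8 * L ^ 3) * (L' ^ 2 - L ^ 2) ^ 2 := by
  unfold barEnergy; ring

theorem barEnergy_nonneg {A L : ℝ} (hA : 0 ≤ A) (hL : 0 ≤ L) (L' : ℝ) : 0 ≤ barEnergy A L L' := by
  rw [barEnergy_eq]; positivity

theorem eq_of_barEnergy_eq_zero {A L L' : ℝ} (hA : 0 < A) (hL : 0 < L) (hL' : 0 ≤ L')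
    (h : barEnergy A L L' = 0) : L' = L := by
  rw [barEnergy_eq] at h
  have h1 : A / (8 * L ^ 3) ≠ 0 := by positivity
  have h2 := pow_eq_zero_iff two_ne_zero |>.1 ((mul_eq_zero.1 h).resolve_left h1)
  exact (sq_eq_sq₀ hL' hL.le).1 (sub_eq_zero.1 h2)

theorem contDiff_barEnergy (A L : ℝ) (i j : Fin s) :
    ContDiff ℝ 1 fun k : Configuration n s => barEnergy A L (dist (k i) (k j)) := by
  simp only [barEnergy_eq, dist_eq_norm]
  have h : ContDiff ℝ 1 fun k : Configuration n s => ‖k i - k j‖ ^ 2 :=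
    ContDiff.norm_sq ℝ (by fun_prop)
  fun_prop

theorem hasDerivAt_norm_sq_line {H : Type*} [NormedAddCommGroup H] [InnerProductSpace ℝ H]
    (d w : H) : HasDerivAt (fun τ : ℝ => ‖d + τ • w‖ ^ 2) (2 * inner ℝ d w) 0 := by
  have h : HasDerivAt (fun τ : ℝ => d + τ • w) w 0 := by
    simpa using ((hasDerivAt_id (0 : ℝ)).smul_const w).const_add d
  simpa using h.norm_sq

/-- Euler's identity: the deviation of the squared length grows at a rate equal to itself, and the
energy is quadratic in it. -/
theorem hasDerivAt_barEnergy (A L : ℝ) (x y u v : EuclideanSpace ℝ (Fin n))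
    (h : inner ℝ (x - y) (u - v) = (dist x y ^ 2 - L ^ 2) / 2) :
    HasDerivAt (fun τ : ℝ => barEnergy A L (dist (x + τ • u) (y + τ • v)))
      (2 * barEnergy A L (dist x y)) 0 := by
  have hd := (((hasDerivAt_norm_sq_line (x - y) (u - v)).sub_const (L ^ 2)).fun_pow 2).const_mul
    (A / (8 * L ^ 3))
  have hfun : (fun τ : ℝ => barEnergy A L (dist (x + τ • u) (y + τ • v))) =
      fun τ => A / (8 * L ^ 3) * (‖x - y + τ • (u - v)‖ ^ 2 - L ^ 2) ^ 2 := by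
    ext τ
    rw [barEnergy_eq, dist_eq_norm]
    congr 5
    module
  rw [hfun]
  refine hd.congr_deriv ?_
  rw [barEnergy_eq, h, dist_eq_norm, zero_smul, add_zero]
  push_cast
  ring

/-- Gram matrix of the edge vectors of a deformed triangle. -/
theorem deformedEdges_gram (x y z : EuclideanSpace ℝ (Fin n)) :
    (deformedEdges x y z).transpose * deformedEdges x y z =
      !![inner ℝ (y - x) (y - x), inner ℝ (y - x) (z - x);
         inner ℝ (y - x) (z - x), inner ℝ (z - x) (z - x)] := by
  ext i j
  fin_cases i <;> fin_cases j <;>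
    simp [deformedEdges, Matrix.mul_apply, PiLp.inner_apply, mul_comm,
      -inner_self_eq_norm_sq_to_K]

/-- Gram matrix of the edge vectors of a planar triangle with the given side lengths. -/
theorem undeformedEdges_gram {a b c : ℝ} (ha : 0 < a)
    (h1 : a < b + c) (h2 : b < a + c) (h3 : c < a + b) :
    (undeformedEdges a b c).transpose * undeformedEdges a b c =
      !![a ^ 2, (a ^ 2 + b ^ 2 - c ^ 2) / 2; (a ^ 2 + b ^ 2 - c ^ 2) / 2, b ^ 2] := by
  have h : 0 ≤ (a + b + c) * (a - b + c) * (a + b - c) * (b + c - a) := by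
    have e1 : 0 < a + b + c := by linarith
    have e2 : 0 < a - b + c := by linarith
    have e3 : 0 < a + b - c := by linarith
    have e4 : 0 < b + c - a := by linarith
    positivity
  have hs := Real.mul_self_sqrt h
  ext i j
  fin_cases i <;> fin_cases j <;> simp [undeformedEdges, Matrix.mul_apply, Fin.sum_univ_two]
  · ring
  · field_simp
  · field_simp
  · field_simp
    -- Heron: the radicand equals `4a²b² - (a² + b² - c²)²`.
    linear_combination hs

/-- The strain as a linear function of the change of the Gram matrix. -/
theorem greenLagrangeStrain_eq {a b c : ℝ} (ha : 0 < a)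
    (h1 : a < b + c) (h2 : b < a + c) (h3 : c < a + b) (x y z : EuclideanSpace ℝ (Fin n)) :
    greenLagrangeStrain a b c x y z = (1 / 2 : ℝ) • ((undeformedEdges a b c)⁻¹.transpose *
      ((deformedEdges x y z).transpose * deformedEdges x y z -
        (undeformedEdges a b c).transpose * undeformedEdges a b c) * (undeformedEdges a b c)⁻¹) := by
  have hu : IsUnit (undeformedEdges a b c).det :=
    isUnit_iff_ne_zero.2 (undeformedEdges_det_ne_zero ha h1 h2 h3)
  have e : (undeformedEdges a b c)⁻¹.transpose *
      ((undeformedEdges a b c).transpose * undeformedEdges a b c) * (undeformedEdges a b c)⁻¹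
        = 1 := by
    rw [← Matrix.mul_assoc, ← Matrix.transpose_mul, Matrix.mul_nonsing_inv _ hu,
      Matrix.transpose_one, Matrix.one_mul, Matrix.mul_nonsing_inv _ hu]
  rw [greenLagrangeStrain, deformationGradient, Matrix.mul_sub, Matrix.sub_mul, e,
    Matrix.transpose_mul]
  simp only [Matrix.mul_assoc]

/-- Completing the square exhibits positive definiteness. -/
theorem strain_quadratic_form (e : Fin 3 → ℝ) :
    e ⬝ᵥ Matrix.mulVec (constitutiveMatrix 1 (1 / 2)) e =
      4 / 3 * ((e 0 + e 1 / 2) ^ 2 + 3 / 4 * e 1 ^ 2 + e 2 ^ 2 / 4) := by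
  simp [constitutiveMatrix, dotProduct, Fin.sum_univ_three, Matrix.mulVec]
  ring

/-- The plate energy in terms of the entries of the strain matrix. -/
theorem plateEnergy_eq (A a b c : ℝ) (x y z : EuclideanSpace ℝ (Fin n)) :
    plateEnergy A a b c x y z = A * (a + b + c) * (2 / 3) *
      ((greenLagrangeStrain a b c x y z 0 0 + greenLagrangeStrain a b c x y z 1 1 / 2) ^ 2 +
        3 / 4 * greenLagrangeStrain a b c x y z 1 1 ^ 2 +
        greenLagrangeStrain a b c x y z 0 1 ^ 2) := by
  rw [plateEnergy, strain_quadratic_form]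
  simp [strainVector]
  ring

theorem plateEnergy_nonneg {A a b c : ℝ} (hA : 0 ≤ A) (h : 0 ≤ a + b + c)
    (x y z : EuclideanSpace ℝ (Fin n)) : 0 ≤ plateEnergy A a b c x y z := by
  rw [plateEnergy_eq]; positivity

theorem contDiff_plateEnergy (A a b c : ℝ) (i j l : Fin s) :
    ContDiff ℝ 1 fun k : Configuration n s => plateEnergy A a b c (k i) (k j) (k l) := by
  have h : ∀ p q, ContDiff ℝ 1 fun k : Configuration n s =>
      greenLagrangeStrain a b c (k i) (k j) (k l) p q := by
    intro p q
    have hF : ∀ m q, ContDiff ℝ 1 fun k : Configuration n s =>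
        deformationGradient a b c (k i) (k j) (k l) m q := by
      intro m q
      simp only [deformationGradient, deformedEdges, Matrix.mul_apply, Fin.sum_univ_two,
        Matrix.of_apply, Matrix.cons_val_zero, Matrix.cons_val_one]
      fun_prop
    simp only [greenLagrangeStrain, Matrix.smul_apply, Matrix.sub_apply, Matrix.mul_apply,
      Matrix.transpose_apply, smul_eq_mul]
    fun_prop
  simp only [plateEnergy_eq]
  fun_prop

/-- Positive definiteness kills the strain; then the deformed and undeformed Gram matrices agree,
and they determine all three sides. -/
theorem undeformed_of_plateEnergy_eq_zero {A a b c : ℝ} (hA : 0 < A) (ha : 0 < a) (hb : 0 < b)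
    (hc : 0 < c) (h1 : a < b + c) (h2 : b < a + c) (h3 : c < a + b)
    {x y z : EuclideanSpace ℝ (Fin n)} (h : plateEnergy A a b c x y z = 0) :
    dist x y = a ∧ dist x z = b ∧ dist y z = c := by
  have hu : IsUnit (undeformedEdges a b c).det :=
    isUnit_iff_ne_zero.2 (undeformedEdges_det_ne_zero ha h1 h2 h3)
  have hut : IsUnit (undeformedEdges a b c).transpose.det := by rwa [Matrix.det_transpose]
  rw [plateEnergy_eq] at h
  have hpos : A * (a + b + c) * (2 / 3) ≠ 0 := by positivity
  have hq := (mul_eq_zero.1 h).resolve_left hpos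
  set S := greenLagrangeStrain a b c x y z with hS
  have s11 : S 1 1 = 0 := by
    nlinarith [sq_nonneg (S 0 0 + S 1 1 / 2), sq_nonneg (S 0 1), sq_nonneg (S 1 1)]
  have s01 : S 0 1 = 0 := by
    nlinarith [sq_nonneg (S 0 0 + S 1 1 / 2), sq_nonneg (S 0 1), sq_nonneg (S 1 1)]
  have s00 : S 0 0 = 0 := by
    rw [s11, s01] at hq
    nlinarith
  have s10 : S 1 0 = 0 := by
    rw [← s01, hS]
    simp [greenLagrangeStrain, Matrix.mul_apply, mul_comm]
  have hS0 : S = 0 := by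
    ext p q
    fin_cases p <;> fin_cases q <;> assumption
  rw [hS, greenLagrangeStrain_eq ha h1 h2 h3, smul_eq_zero] at hS0
  have h0 := hS0.resolve_left (by norm_num)
  set B := undeformedEdges a b c with hB
  set C := (deformedEdges x y z).transpose * deformedEdges x y z - B.transpose * B with hC
  have hC0 : C = 0 := by
    -- Undoing the congruence by `B⁻¹` recovers the Gram difference from the strain.
    have e : B.transpose * (B⁻¹.transpose * C * B⁻¹) * B = C := by
      rw [Matrix.mul_assoc, Matrix.mul_assoc, Matrix.nonsing_inv_mul _ hu, Matrix.mul_one,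
        ← Matrix.mul_assoc, ← Matrix.transpose_mul, Matrix.nonsing_inv_mul _ hu,
        Matrix.transpose_one, Matrix.one_mul]
    rw [← e, h0, Matrix.mul_zero, Matrix.zero_mul]
  rw [hC, sub_eq_zero, deformedEdges_gram, hB, undeformedEdges_gram ha h1 h2 h3] at hC0
  have g00 := congrFun (congrFun hC0 0) 0
  have g01 := congrFun (congrFun hC0 0) 1
  have g11 := congrFun (congrFun hC0 1) 1
  simp only [Matrix.of_apply, Matrix.cons_val_zero, Matrix.cons_val_one, Matrix.cons_val',
    Matrix.cons_val_fin_one, real_inner_self_eq_norm_sq] at g00 g01 g11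
  have g22 : ‖z - y‖ ^ 2 = c ^ 2 := by
    have := norm_sub_sq_real (z - x) (y - x)
    rw [real_inner_comm, sub_sub_sub_cancel_right] at this
    rw [this, g00, g01, g11]; ring
  rw [dist_comm x y, dist_comm x z, dist_comm y z, dist_eq_norm, dist_eq_norm, dist_eq_norm]
  exact ⟨(sq_eq_sq₀ (norm_nonneg _) ha.le).1 g00, (sq_eq_sq₀ (norm_nonneg _) hb.le).1 g11,
    (sq_eq_sq₀ (norm_nonneg _) hc.le).1 g22⟩

/-- If the velocities change the squared side lengths at rates equal to their deviations from the
undeformed ones, then the strain grows at a rate equal to itself. -/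
theorem hasDerivAt_greenLagrangeStrain {a b c : ℝ} (ha : 0 < a)
    (h1 : a < b + c) (h2 : b < a + c) (h3 : c < a + b) (x y z u v w : EuclideanSpace ℝ (Fin n))
    (hxy : inner ℝ (x - y) (u - v) = (dist x y ^ 2 - a ^ 2) / 2)
    (hxz : inner ℝ (x - z) (u - w) = (dist x z ^ 2 - b ^ 2) / 2)
    (hyz : inner ℝ (y - z) (v - w) = (dist y z ^ 2 - c ^ 2) / 2) (p q : Fin 2) :
    HasDerivAt (fun τ : ℝ => greenLagrangeStrain a b c (x + τ • u) (y + τ • v) (z + τ • w) p q)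
      (greenLagrangeStrain a b c x y z p q) 0 := by
  let B := undeformedEdges a b c
  let C : ℝ → Matrix (Fin 2) (Fin 2) ℝ := fun τ =>
    (deformedEdges (x + τ • u) (y + τ • v) (z + τ • w)).transpose *
      deformedEdges (x + τ • u) (y + τ • v) (z + τ • w) - B.transpose * B
  let N : EuclideanSpace ℝ (Fin n) → EuclideanSpace ℝ (Fin n) → EuclideanSpace ℝ (Fin n) →
      EuclideanSpace ℝ (Fin n) → ℝ → ℝ := fun d e f g τ => ‖d + τ • f - (e + τ • g)‖ ^ 2
  have hN : ∀ d e f g l, inner ℝ (d - e) (f - g) = (dist d e ^ 2 - l ^ 2) / 2 →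
      HasDerivAt (N d e f g) (N d e f g 0 - l ^ 2) 0 := by
    intro d e f g l h
    have hfun : N d e f g = fun τ => ‖d - e + τ • (f - g)‖ ^ 2 := by
      ext τ
      simp only [N]
      congr 2
      module
    rw [hfun]
    refine (hasDerivAt_norm_sq_line _ _).congr_deriv ?_
    simp only [h, dist_eq_norm, zero_smul, add_zero]
    ring
  have hpol : ∀ d e f : EuclideanSpace ℝ (Fin n), (inner ℝ (e - d) (f - d) : ℝ) =
      (‖d - e‖ ^ 2 + ‖d - f‖ ^ 2 - ‖e - f‖ ^ 2) / 2 := by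
    intro d e f
    have h := norm_sub_sq_real (e - d) (f - d)
    rw [sub_sub_sub_cancel_right, norm_sub_rev e d, norm_sub_rev f d] at h
    rw [h]
    ring
  -- By polarization the entries of `C` are fixed linear combinations of the three deviations, and
  -- so inherit the property of growing at a rate equal to themselves.
  have hC : ∀ p q, HasDerivAt (fun τ => C τ p q) (C 0 p q) 0 := by
    have dX := hN x y u v a hxy
    have dY := hN x z u w b hxz
    have dZ := hN y z v w c hyz
    have dM := (((dX.fun_add dY).fun_sub dZ).div_const 2).sub_const ((a ^ 2 + b ^ 2 - c ^ 2) / 2)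
    have hM : ∀ τ, C τ = !![N x y u v τ - a ^ 2,
        (N x y u v τ + N x z u w τ - N y z v w τ) / 2 - (a ^ 2 + b ^ 2 - c ^ 2) / 2;
        (N x y u v τ + N x z u w τ - N y z v w τ) / 2 - (a ^ 2 + b ^ 2 - c ^ 2) / 2,
        N x z u w τ - b ^ 2] := by
      intro τ
      simp only [C, B]
      rw [deformedEdges_gram, undeformedEdges_gram ha h1 h2 h3, real_inner_self_eq_norm_sq,
        real_inner_self_eq_norm_sq, hpol, norm_sub_rev (y + τ • v) (x + τ • u),
        norm_sub_rev (z + τ • w) (x + τ • u)]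
      ext p q
      fin_cases p <;> fin_cases q <;> rfl
    intro p q
    simp only [hM]
    fin_cases p <;> fin_cases q
    · exact dX.sub_const (a ^ 2)
    · exact dM.congr_deriv (by simp; ring)
    · exact dM.congr_deriv (by simp; ring)
    · exact dY.sub_const (b ^ 2)
  have hexp : ∀ τ, greenLagrangeStrain a b c (x + τ • u) (y + τ • v) (z + τ • w) p q =
      1 / 2 * ∑ m, (∑ l, B⁻¹ l p * C τ l m) * B⁻¹ m q := by
    intro τ
    rw [greenLagrangeStrain_eq ha h1 h2 h3]
    simp [Matrix.mul_apply, C, B]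
  have h0 := hexp 0
  simp only [zero_smul, add_zero] at h0
  rw [h0]
  simp only [hexp]
  refine HasDerivAt.const_mul _ (HasDerivAt.fun_sum fun m _ => HasDerivAt.mul_const ?_ _)
  exact HasDerivAt.fun_sum fun l _ => (hC l m).const_mul _

theorem hasDerivAt_plateEnergy (A : ℝ) {a b c : ℝ} (ha : 0 < a)
    (h1 : a < b + c) (h2 : b < a + c) (h3 : c < a + b) (x y z u v w : EuclideanSpace ℝ (Fin n))
    (hxy : inner ℝ (x - y) (u - v) = (dist x y ^ 2 - a ^ 2) / 2)
    (hxz : inner ℝ (x - z) (u - w) = (dist x z ^ 2 - b ^ 2) / 2)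
    (hyz : inner ℝ (y - z) (v - w) = (dist y z ^ 2 - c ^ 2) / 2) :
    HasDerivAt (fun τ : ℝ => plateEnergy A a b c (x + τ • u) (y + τ • v) (z + τ • w))
      (2 * plateEnergy A a b c x y z) 0 := by
  have hs := hasDerivAt_greenLagrangeStrain ha h1 h2 h3 x y z u v w hxy hxz hyz
  simp only [plateEnergy_eq]
  have hd := (((((hs 0 0).fun_add ((hs 1 1).div_const 2)).fun_pow 2).fun_add
    (((hs 1 1).fun_pow 2).const_mul (3 / 4))).fun_add ((hs 0 1).fun_pow 2)).const_mul
      (A * (a + b + c) * (2 / 3))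
  refine hd.congr_deriv ?_
  simp only [zero_smul, add_zero]
  push_cast
  ring

end Energy

/-! ### Total energy: zero set and critical points -/

namespace BarPlateFramework

variable {n s : ℕ} (F : BarPlateFramework s)

theorem mem_bars {e : Fin s × Fin s} :
    e ∈ F.bars ↔ e.1 < e.2 ∧ F.graph.Adj e.1 e.2 ∧ ¬ F.IsPlateSide e.1 e.2 := by
  simp [bars]

theorem plate_length_pos {i j k : Fin s} (h : (i, j, k) ∈ F.plates) :
    0 < F.length i j ∧ 0 < F.length i k ∧ 0 < F.length j k := by
  obtain ⟨hij, hjk⟩ := F.plate_lt i j k h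
  obtain ⟨a1, a2, a3⟩ := F.plate_adj i j k h
  exact ⟨F.length_pos i j hij a1, F.length_pos i k (hij.trans hjk) a2, F.length_pos j k hjk a3⟩

theorem contDiff_energy : ContDiff ℝ 1 (F.energy (n := n)) :=
  (ContDiff.sum fun _ _ => contDiff_barEnergy _ _ _ _).add
    (ContDiff.sum fun _ _ => contDiff_plateEnergy _ _ _ _ _ _ _)

theorem barEnergy_nonneg_of_mem (k : Configuration n s) {e : Fin s × Fin s} (he : e ∈ F.bars) :
    0 ≤ barEnergy F.area (F.length e.1 e.2) (dist (k e.1) (k e.2)) :=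
  barEnergy_nonneg F.area_pos.le
    (F.length_pos _ _ (F.mem_bars.1 he).1 (F.mem_bars.1 he).2.1).le _

theorem plateEnergy_nonneg_of_mem (k : Configuration n s) {p : Fin s × Fin s × Fin s}
    (hp : p ∈ F.plates) : 0 ≤ plateEnergy F.area
      (F.length p.1 p.2.1) (F.length p.1 p.2.2) (F.length p.2.1 p.2.2)
      (k p.1) (k p.2.1) (k p.2.2) := by
  obtain ⟨h1, h2, h3⟩ := F.plate_length_pos hp
  exact plateEnergy_nonneg F.area_pos.le (by positivity) _ _ _

theorem energy_nonneg (k : Configuration n s) : 0 ≤ F.energy k :=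
  add_nonneg (Finset.sum_nonneg fun _ he => F.barEnergy_nonneg_of_mem k he)
    (Finset.sum_nonneg fun _ hp => F.plateEnergy_nonneg_of_mem k hp)

theorem isUndeformed_of_energy_eq_zero {k : Configuration n s} (h : F.energy k = 0) :
    F.IsUndeformed k := by
  obtain ⟨hb, hp⟩ := (add_eq_zero_iff_of_nonneg
    (Finset.sum_nonneg fun _ he => F.barEnergy_nonneg_of_mem k he)
    (Finset.sum_nonneg fun _ hp => F.plateEnergy_nonneg_of_mem k hp)).1 h
  rw [Finset.sum_eq_zero_iff_of_nonneg fun _ he => F.barEnergy_nonneg_of_mem k he] at hb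
  rw [Finset.sum_eq_zero_iff_of_nonneg fun _ hp => F.plateEnergy_nonneg_of_mem k hp] at hp
  have hplate : ∀ i j l, (i, j, l) ∈ F.plates → dist (k i) (k j) = F.length i j ∧
      dist (k i) (k l) = F.length i l ∧ dist (k j) (k l) = F.length j l := by
    intro i j l hm
    obtain ⟨p1, p2, p3⟩ := F.plate_length_pos hm
    obtain ⟨t1, t2, t3⟩ := F.plate_triangle i j l hm
    exact undeformed_of_plateEnergy_eq_zero F.area_pos p1 p2 p3 t1 t2 t3 (hp _ hm)
  intro i j hij ha
  by_cases hside : F.IsPlateSide i j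
  · obtain ⟨l, hl | hl | hl⟩ := hside
    · exact (hplate _ _ _ hl).1
    · exact (hplate _ _ _ hl).2.1
    · exact (hplate _ _ _ hl).2.2
  · exact eq_of_barEnergy_eq_zero F.area_pos (F.length_pos i j hij ha) dist_nonneg
      (hb (i, j) (F.mem_bars.2 ⟨hij, ha, hside⟩))

theorem hasDerivAt_energy {k v : Configuration n s}
    (hv : ∀ i j, i < j → F.graph.Adj i j →
      inner ℝ (k i - k j) (v i - v j) = (dist (k i) (k j) ^ 2 - F.length i j ^ 2) / 2) :
    HasDerivAt (fun τ : ℝ => F.energy (k + τ • v)) (2 * F.energy k) 0 := by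
  rw [energy, mul_add, Finset.mul_sum, Finset.mul_sum]
  refine HasDerivAt.fun_add (HasDerivAt.fun_sum fun e he => ?_) (HasDerivAt.fun_sum fun p hp => ?_)
  · obtain ⟨h1, h2, -⟩ := F.mem_bars.1 he
    exact hasDerivAt_barEnergy _ _ _ _ _ _ (hv _ _ h1 h2)
  · obtain ⟨i, j, l⟩ := p
    obtain ⟨hij, hjl⟩ := F.plate_lt i j l hp
    obtain ⟨a1, a2, a3⟩ := F.plate_adj i j l hp
    obtain ⟨t1, t2, t3⟩ := F.plate_triangle i j l hp
    exact hasDerivAt_plateEnergy _ (F.plate_length_pos hp).1 t1 t2 t3 _ _ _ _ _ _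
      (hv i j hij a1) (hv i l (hij.trans hjl) a2) (hv j l hjl a3)

/-- A critical point of the strain energy of an isostatic framework that stores energy is shaky. -/
theorem isShaky_of_fderiv_eq_zero (hiso : IsIsostatic n F.graph) {k : Configuration n s}
    (hcrit : fderiv ℝ (F.energy (n := n)) k = 0) (hpos : F.energy k ≠ 0) :
    IsShaky F.graph k := by
  by_contra hk
  obtain ⟨v, hv⟩ := hiso.exists_velocity hk
    -- Half the deviation, because a squared length changes at twice the inner product.
    fun i j => (dist (k i) (k j) ^ 2 - F.length i j ^ 2) / 2
  have hline : HasDerivAt (fun τ : ℝ => k + τ • v) v 0 := by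
    simpa using ((hasDerivAt_id (0 : ℝ)).smul_const v).const_add k
  have hf : HasFDerivAt (F.energy (n := n)) (fderiv ℝ (F.energy (n := n)) k)
      (k + (0 : ℝ) • v) := by
    simpa using ((F.contDiff_energy.differentiable one_ne_zero) k).hasFDerivAt
  rw [hcrit] at hf
  have hcomp := hf.comp_hasDerivAt (0 : ℝ) hline
  have h : (0 : ℝ) = 2 * F.energy k := hcomp.unique (F.hasDerivAt_energy hv)
  exact hpos (by linarith)

end BarPlateFramework

/-! ### The snap -/

theorem theorem2 {n s : ℕ} (F : BarPlateFramework s) (hiso : IsIsostatic n F.graph)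
    (k k'' : Configuration n s) (hsnap : F.CanSnap k k'')
    (γ : Path k k'') (hmin : F.UsesMinimumEnergy γ) :
    (∃ t : unitInterval, 0 < t ∧ t < 1 ∧ (∀ τ, F.energy (γ τ) ≤ F.energy (γ t)) ∧
      IsShaky F.graph (γ t)) ∧
    (F.IsUndeformed k'' ∨ (¬ F.IsUndeformed k'' ∧ IsShaky F.graph k'')) := by
  obtain ⟨-, hk'', hbarrier⟩ := hsnap
  have hU : Continuous (F.energy (n := n)) := F.contDiff_energy.continuous
  have hbdd : ∀ δ : Path k k'', BddAbove (Set.range fun t => F.energy (δ t)) := fun δ =>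
    (isCompact_range (hU.comp δ.continuous)).bddAbove
  have hmax : ∀ δ : Path k k'', ∃ t, ∀ τ, F.energy (δ τ) ≤ F.energy (δ t) := by
    intro δ
    obtain ⟨t, -, ht⟩ := isCompact_univ.exists_isMaxOn Set.univ_nonempty
      (hU.comp δ.continuous).continuousOn
    exact ⟨t, fun τ => ht (Set.mem_univ τ)⟩
  refine ⟨?_, ?_⟩
  · obtain ⟨t₀, ht₀⟩ := hmax γ
    obtain ⟨t₁, ht₁⟩ := hbarrier γ
    have hkM : F.energy k < F.energy (γ t₀) := ht₁.trans_le (ht₀ t₁)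
    have hMpos : 0 < F.energy (γ t₀) := (F.energy_nonneg k).trans_lt hkM
    have hkM'' : F.energy k'' ≤ F.energy (γ t₀) := by simpa using ht₀ 1
    rcases hkM''.lt_or_eq with hlt | heq
    · by_contra! hno
      obtain ⟨δ, hδ⟩ := exists_path_lt_of_regular F.contDiff_energy γ ht₀ hkM hlt (by
        intro t ht hcrit
        refine hno t (unitInterval.pos_iff_ne_zero.2 ?_) (unitInterval.lt_one_iff_ne_one.2 ?_)
          (fun τ => (ht₀ τ).trans ht.ge)
          (F.isShaky_of_fderiv_eq_zero hiso hcrit (by rw [ht]; exact hMpos.ne'))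
        · rintro rfl
          rw [γ.source] at ht
          exact hkM.ne ht
        · rintro rfl
          rw [γ.target] at ht
          exact hlt.ne ht)
      obtain ⟨t₂, ht₂⟩ := hmax δ
      have h1 : F.energy (γ t₀) ≤ F.peakEnergy γ := le_ciSup (hbdd γ) t₀
      have h2 : F.peakEnergy δ ≤ F.energy (δ t₂) := ciSup_le ht₂
      exact absurd ((h1.trans (hmin δ)).trans h2) (hδ t₂).not_ge
    · -- The peak is attained at the stable final realization, hence also shortly before it.
      have hev : ∀ᶠ x in 𝓝 k'', F.energy k'' ≤ F.energy x := hk''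
      have hγ1 : Tendsto γ (𝓝 1) (𝓝 k'') := by
        simpa using γ.continuous.tendsto 1
      -- The local lower bound at `k''` holds around each nearby point as well; with the peak bound
      -- it makes late path points local minima of the same energy.
      have hnear : ∀ᶠ t in 𝓝 (1 : unitInterval),
          0 < t ∧ ∀ᶠ x in 𝓝 (γ t), F.energy k'' ≤ F.energy x :=
        (lt_mem_nhds zero_lt_one).and (hγ1.eventually (eventually_eventually_nhds.2 hev))
      have hne : (𝓝[<] (1 : unitInterval)).NeBot := nhdsLT_neBot_of_exists_lt ⟨0, zero_lt_one⟩
      obtain ⟨t, ⟨ht0, ht⟩, ht1⟩ := ((hnear.filter_mono nhdsWithin_le_nhds).and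
        (self_mem_nhdsWithin (s := Set.Iio (1 : unitInterval)))).exists
      have hval : F.energy (γ t) = F.energy k'' :=
        le_antisymm ((ht₀ t).trans heq.ge) ht.self_of_nhds
      have hloc : IsLocalMin (F.energy (n := n)) (γ t) := by
        filter_upwards [ht] with x hx using hval.le.trans hx
      exact ⟨t, ht0, ht1, fun τ => (ht₀ τ).trans (heq.ge.trans hval.ge),
        F.isShaky_of_fderiv_eq_zero hiso hloc.fderiv_eq_zero
          (by rw [hval, heq]; exact hMpos.ne')⟩
  · by_cases hund : F.IsUndeformed k''
    · exact Or.inl hund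
    · exact Or.inr ⟨hund, F.isShaky_of_fderiv_eq_zero hiso hk''.fderiv_eq_zero
        fun h => hund (F.isUndeformed_of_energy_eq_zero h)⟩
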